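/- Let $n\ge 2$. Call a nonempty connected open set $V\subset\mathbb C^n$ a Stein domain if it is holomorphically convex, that is, if for every compact $K\subset V$ the hull $$\widehat K_V=\Bigl\{z\in V:\ |f(z)|\le\sup_{w\in K}|f(w)|\ \text{ for every holomorphic } f:V\to\mathbb C\Bigr\}$$ is relatively compact in $V$. Let $A\subset\mathbb C^n$ be a Stein compactum, that is, a compact set with a neighbourhood basis of Stein domains: every neighbourhood of $A$ contains a Stein domain $V$ with $A\subset V$. Then the complement $\mathbb C^n\setminus A$ is connected. -/

import Mathlib

open Topology

/-- The holomorphically convex hull of `K` with respect to `V`: the points `z ∈ V` such that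
`|f z| ≤ sup_{w ∈ K} |f w|` for every function `f` holomorphic on `V`. -/
def holomorphicHull {n : ℕ} (V K : Set (EuclideanSpace ℂ (Fin n))) :
    Set (EuclideanSpace ℂ (Fin n)) :=
  {z | z ∈ V ∧ ∀ f : EuclideanSpace ℂ (Fin n) → ℂ, DifferentiableOn ℂ f V →
    ‖f z‖ ≤ sSup ((fun w => ‖f w‖) '' K)}

/-- A Stein domain in `ℂⁿ`: a nonempty connected open set that is holomorphically convex, i.e.
the hull of each of its compact subsets is relatively compact in it. (Holomorphic functions
separate the points of, and give local coordinates on, any open subset of `ℂⁿ`, because the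
coordinate functions do; so these two conditions in the definition of a Stein manifold are
automatic here.) -/
structure IsSteinDomain {n : ℕ} (V : Set (EuclideanSpace ℂ (Fin n))) : Prop where
  isOpen : IsOpen V
  isConnected : IsConnected V
  holomorphicallyConvex : ∀ K ⊆ V, IsCompact K →
    IsCompact (closure (holomorphicHull V K)) ∧ closure (holomorphicHull V K) ⊆ V

/-- A Stein compactum in `ℂⁿ`: a compact set with a neighbourhood basis of Stein domains. -/
structure IsSteinCompactum {n : ℕ} (A : Set (EuclideanSpace ℂ (Fin n))) : Prop where
  isCompact : IsCompact A
  exists_steinDomain : ∀ U ∈ 𝓝ˢ A, ∃ V, IsSteinDomain V ∧ A ⊆ V ∧ V ⊆ U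

/-! If the complement of `A` were disconnected, it would have a bounded component `C`. A Stein
domain `V` around `A` can be chosen to miss a point of `C`; let `q` be a point of `closure C \ V`
farthest from some `a ∈ A`. Near `q`, every point farther from `a` lies in `V`. Small complex discs
orthogonal to `q - a`, pushed slightly outward, then lie in `V`, and their boundary circles stay in
a compact part of `V` as the discs move back to `q`. By the maximum principle their centres lie in
the hull of that compact set, so holomorphic convexity puts the limit `q` in `V`, a contradiction.
-/

/-- The complement of a closed ball is connected in real dimension at least two. -/
theorem isConnected_compl_closedBall_zero {E : Type*} [NormedAddCommGroup E] [NormedSpace ℝ E]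
    (h : 1 < Module.rank ℝ E) {r : ℝ} (hr : 0 ≤ r) :
    IsConnected (Metric.closedBall (0 : E) r)ᶜ := by
  have hs := (isConnected_sphere h (0 : E) zero_le_one).prod (isConnected_Ioi (a := r))
  have himage : (fun x : E × ℝ => x.2 • x.1) '' (Metric.sphere (0 : E) 1 ×ˢ Set.Ioi r) =
      (Metric.closedBall (0 : E) r)ᶜ := by
    ext x
    simp only [Set.mem_image, Set.mem_prod, mem_sphere_zero_iff_norm, Set.mem_Ioi, Prod.exists,
      Set.mem_compl_iff, mem_closedBall_zero_iff, not_le]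
    constructor
    · rintro ⟨y, t, ⟨hy, ht⟩, rfl⟩
      rwa [norm_smul, hy, mul_one, Real.norm_of_nonneg (hr.trans ht.le)]
    · intro hx
      have hx0 : ‖x‖ ≠ 0 := (hr.trans_lt hx).ne'
      exact ⟨‖x‖⁻¹ • x, ‖x‖, ⟨by simp [norm_smul, hx0], hx⟩, smul_inv_smul₀ hx0 x⟩
  rw [← himage]
  exact hs.image _ (by fun_prop)

/-- In a locally connected space, the frontier of a component of an open set `U` avoids `U`. -/
theorem IsOpen.closure_connectedComponentIn_inter_subset {X : Type*} [TopologicalSpace X]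
    [LocallyConnectedSpace X] {U : Set X} (hU : IsOpen U) (x : X) :
    closure (connectedComponentIn U x) ∩ U ⊆ connectedComponentIn U x := by
  rintro y ⟨hy, hyU⟩
  obtain ⟨z, hzy, hzx⟩ :=
    mem_closure_iff.1 hy _ hU.connectedComponentIn (mem_connectedComponentIn hyU)
  rw [connectedComponentIn_eq hzx, ← connectedComponentIn_eq hzy]
  exact mem_connectedComponentIn hyU

/-- If the complement of a bounded set is not connected, it has a bounded component. -/
theorem exists_isBounded_connectedComponentIn_compl {E : Type*} [NormedAddCommGroup E]
    [NormedSpace ℝ E] (h : 1 < Module.rank ℝ E) {A : Set E} (hA : Bornology.IsBounded A)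
    (hconn : ¬ IsConnected Aᶜ) :
    ∃ p ∈ Aᶜ, Bornology.IsBounded (connectedComponentIn Aᶜ p) := by
  obtain ⟨r, hr, hAr⟩ := hA.subset_closedBall_lt 0 (0 : E)
  have hball := isConnected_compl_closedBall_zero h hr.le
  have hsub : (Metric.closedBall (0 : E) r)ᶜ ⊆ Aᶜ := Set.compl_subset_compl.2 hAr
  by_contra! hunb
  obtain ⟨x, hx⟩ := hball.nonempty
  -- An unbounded component must meet the exterior of the ball, which is connected and so lies in a
  -- single component.
  have hcomp : Aᶜ ⊆ connectedComponentIn Aᶜ x := by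
    intro p hp
    have hnot : ¬ connectedComponentIn Aᶜ p ⊆ Metric.closedBall 0 r :=
      fun hle => hunb p hp (Metric.isBounded_closedBall.subset hle)
    obtain ⟨y, hyp, hy⟩ := Set.not_subset.1 hnot
    have hyx : y ∈ connectedComponentIn Aᶜ x :=
      hball.isPreconnected.subset_connectedComponentIn hx hsub hy
    rw [connectedComponentIn_eq hyx, ← connectedComponentIn_eq hyp]
    exact mem_connectedComponentIn hp
  refine hconn ⟨⟨x, hsub hx⟩, ?_⟩
  rw [← (connectedComponentIn_subset Aᶜ x).antisymm hcomp]
  exact isPreconnected_connectedComponentIn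

/-- The centre of a closed affine disc in `V` whose boundary circle lies in a compact set `K`
belongs to the holomorphically convex hull of `K`. -/
theorem mem_holomorphicHull_of_disc {n : ℕ} {V K : Set (EuclideanSpace ℂ (Fin n))}
    (hV : IsOpen V) (hK : IsCompact K) (hKV : K ⊆ V) {c e : EuclideanSpace ℂ (Fin n)} {δ : ℝ}
    (hδ : 0 < δ) (hdisc : ∀ ζ : ℂ, ‖ζ‖ ≤ δ → c + ζ • e ∈ V)
    (hcircle : ∀ ζ : ℂ, ‖ζ‖ = δ → c + ζ • e ∈ K) :
    c ∈ holomorphicHull V K := by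
  refine ⟨by simpa using hdisc 0 (by simpa using hδ.le), fun f hf => ?_⟩
  -- Without boundedness the real `sSup` would take its default value 0.
  have hbdd : BddAbove ((fun w => ‖f w‖) '' K) :=
    (hK.image_of_continuousOn (hf.continuousOn.mono hKV).norm).bddAbove
  have hd : DifferentiableOn ℂ (fun ζ : ℂ => f (c + ζ • e)) (closure (Metric.ball 0 δ)) := by
    intro ζ hζ
    rw [closure_ball _ hδ.ne', mem_closedBall_zero_iff] at hζ
    have hfζ : DifferentiableAt ℂ f (c + ζ • e) :=
      hf.differentiableAt (hV.mem_nhds (hdisc ζ hζ))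
    exact (hfζ.comp ζ (by fun_prop)).differentiableWithinAt
  have hmax := Complex.norm_le_of_forall_mem_frontier_norm_le (Metric.isBounded_ball)
    hd.diffContOnCl (C := sSup ((fun w => ‖f w‖) '' K)) (fun ζ hζ => by
      rw [frontier_ball _ hδ.ne', mem_sphere_zero_iff_norm] at hζ
      exact le_csSup hbdd ⟨_, hcircle ζ hζ, rfl⟩) (subset_closure (Metric.mem_ball_self hδ))
  simpa using hmax

/-- A vector that moves outward along `v` and orthogonally to `v` gets longer. -/
theorem norm_lt_norm_add_smul_add_smul {E : Type*} [NormedAddCommGroup E] [InnerProductSpace ℂ E]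
    {v e : E} (hv : v ≠ 0) (he : e ≠ 0) (hve : inner ℂ v e = 0) {t : ℝ} (ht : 0 ≤ t) {ζ : ℂ}
    (h : 0 < t ∨ ζ ≠ 0) : ‖v‖ < ‖v + (t : ℂ) • v + ζ • e‖ := by
  have hv' := norm_pos_iff.2 hv
  have he' := norm_pos_iff.2 he
  have hpyth := norm_add_sq_eq_norm_sq_add_norm_sq_of_inner_eq_zero
    (𝕜 := ℂ) ((1 + (t : ℂ)) • v) (ζ • e) (by simp [inner_smul_left, inner_smul_right, hve])
  have hcoef : ‖(1 + (t : ℂ))‖ = 1 + t := by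
    rw [← Complex.ofReal_one, ← Complex.ofReal_add, Complex.norm_of_nonneg (by linarith)]
  rw [norm_smul, norm_smul, hcoef, add_smul, one_smul] at hpyth
  have hle : ‖v‖ ≤ (1 + t) * ‖v‖ := by nlinarith
  refine lt_of_pow_lt_pow_left₀ 2 (norm_nonneg _) ?_
  rcases h with h | h
  · have : ‖v‖ < (1 + t) * ‖v‖ := by nlinarith
    nlinarith [mul_self_nonneg (‖ζ‖ * ‖e‖)]
  · have : 0 < ‖ζ‖ * ‖e‖ := mul_pos (norm_pos_iff.2 h) he'
    nlinarith [mul_pos this this]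

/-- In dimension at least two, every vector has a nonzero orthogonal vector. -/
theorem exists_ne_zero_inner_eq_zero {n : ℕ} (hn : 2 ≤ n) (v : EuclideanSpace ℂ (Fin n)) :
    ∃ e : EuclideanSpace ℂ (Fin n), e ≠ 0 ∧ inner ℂ v e = 0 := by
  have hbot : (Submodule.span ℂ {v})ᗮ ≠ ⊥ := by
    intro h
    rw [Submodule.orthogonal_eq_bot_iff] at h
    have hle := finrank_span_le_card (R := ℂ) ({v} : Set (EuclideanSpace ℂ (Fin n)))
    rw [h, finrank_top, finrank_euclideanSpace_fin, Set.toFinset_card, Fintype.card_unique] at hle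
    omega
  obtain ⟨e, he, he0⟩ := Submodule.exists_mem_ne_zero_of_ne_bot hbot
  exact ⟨e, he0, Submodule.mem_orthogonal_singleton_iff_inner_right.1 he⟩

/-- If `V` contains all points of a neighbourhood `W` of `q` that are farther from `a` than `q`,
and `V` is holomorphically convex, then `q` belongs to `V`. -/
theorem IsSteinDomain.mem_of_farther_subset {n : ℕ} (hn : 2 ≤ n)
    {V W : Set (EuclideanSpace ℂ (Fin n))} (hV : IsSteinDomain V)
    {a q : EuclideanSpace ℂ (Fin n)} (hqa : q ≠ a) (hW : W ∈ 𝓝 q)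
    (h : ∀ x ∈ W, dist q a < dist x a → x ∈ V) : q ∈ V := by
  set v := q - a with hv
  have hv0 : v ≠ 0 := sub_ne_zero.2 hqa
  obtain ⟨e, he0, hve⟩ := exists_ne_zero_inner_eq_zero hn v
  let φ : ℝ × ℂ → EuclideanSpace ℂ (Fin n) := fun x => q + (x.1 : ℂ) • v + x.2 • e
  have hφ : Continuous φ := by fun_prop
  have hφ0 : φ 0 = q := by simp [φ]
  have hnhds : φ ⁻¹' W ∈ 𝓝 (0 : ℝ × ℂ) := hφ.continuousAt (by rwa [hφ0])
  obtain ⟨δ, hδ, hδW⟩ := Metric.nhds_basis_closedBall.mem_iff.1 hnhds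
  have hφV : ∀ (t : ℝ) (ζ : ℂ), 0 ≤ t → t ≤ δ → ‖ζ‖ ≤ δ → (0 < t ∨ ζ ≠ 0) → φ (t, ζ) ∈ V := by
    intro t ζ ht htδ hζ hpos
    refine h _ (hδW ?_) ?_
    · rw [mem_closedBall_zero_iff, Prod.norm_def]
      exact max_le (by rwa [Real.norm_of_nonneg ht]) hζ
    · have hlt := norm_lt_norm_add_smul_add_smul hv0 he0 hve ht hpos
      have hsub : φ (t, ζ) - a = v + (t : ℂ) • v + ζ • e := by
        simp only [φ, hv]
        abel
      rwa [dist_eq_norm, dist_eq_norm, hsub]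
  -- Including `t = 0` makes `K` compact. The circle at `t = 0` already lies in `V`; only the centre
  -- `q` of that disc is in doubt.
  let K := φ '' (Set.Icc 0 δ ×ˢ Metric.sphere 0 δ)
  have hK : IsCompact K := (isCompact_Icc.prod (isCompact_sphere _ _)).image hφ
  have hKV : K ⊆ V := by
    rintro _ ⟨⟨t, ζ⟩, ⟨ht, hζ⟩, rfl⟩
    rw [mem_sphere_zero_iff_norm] at hζ
    exact hφV t ζ ht.1 ht.2 hζ.le (.inr (norm_pos_iff.1 (hζ ▸ hδ)))
  have hhull : ∀ t ∈ Set.Ioc 0 δ, φ (t, 0) ∈ holomorphicHull V K := by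
    intro t ht
    have hc : φ (t, 0) = q + (t : ℂ) • v := by simp [φ]
    rw [hc]
    exact mem_holomorphicHull_of_disc hV.isOpen hK hKV hδ
      (fun ζ hζ => hφV t ζ ht.1.le ht.2 hζ (.inl ht.1))
      (fun ζ hζ => ⟨(t, ζ), ⟨⟨ht.1.le, ht.2⟩, mem_sphere_zero_iff_norm.2 hζ⟩, rfl⟩)
  have htendsto : Filter.Tendsto (fun t : ℝ => φ (t, 0)) (𝓝[>] 0) (𝓝 q) := by
    have hcont : Continuous fun t : ℝ => φ (t, 0) := by fun_prop
    have := hcont.tendsto 0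
    rw [show φ (0, 0) = q from hφ0] at this
    exact this.mono_left nhdsWithin_le_nhds
  refine (hV.holomorphicallyConvex K hKV hK).2 (mem_closure_of_tendsto htendsto ?_)
  filter_upwards [Ioc_mem_nhdsGT hδ] with t ht using hhull t ht

theorem mainTheorem6 (n : ℕ) (hn : 2 ≤ n) (A : Set (EuclideanSpace ℂ (Fin n)))
    (hA : IsSteinCompactum A) : IsConnected Aᶜ := by
  by_contra hconn
  have hrank : 1 < Module.rank ℝ (EuclideanSpace ℂ (Fin n)) := by
    rw [← Module.finrank_eq_rank, finrank_real_of_complex, finrank_euclideanSpace_fin]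
    exact_mod_cast (by omega : 1 < 2 * n)
  -- If `A` were empty, `∅` would be a neighbourhood of it containing a Stein domain, but Stein
  -- domains are nonempty.
  obtain ⟨a, ha⟩ : A.Nonempty := by
    by_contra hempty
    rw [Set.not_nonempty_iff_eq_empty] at hempty
    obtain ⟨V, hV, -, hVe⟩ := hA.exists_steinDomain ∅ (by simp [hempty])
    exact (hV.isConnected.nonempty.mono hVe).ne_empty rfl
  obtain ⟨p, hp, hbdd⟩ :=
    exists_isBounded_connectedComponentIn_compl hrank hA.isCompact.isBounded hconn
  have hAo : IsOpen Aᶜ := hA.isCompact.isClosed.isOpen_compl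
  set C := connectedComponentIn Aᶜ p with hC
  obtain ⟨V, hV, hAV, hVp⟩ := hA.exists_steinDomain {p}ᶜ
    (isOpen_compl_singleton.mem_nhdsSet.2 (Set.subset_compl_singleton_iff.2 hp))
  have hpV : p ∉ V := fun hpV => hVp hpV rfl
  have hL : IsCompact (closure C \ V) := hbdd.isCompact_closure.diff hV.isOpen
  obtain ⟨q, ⟨hqC, hqV⟩, hqmax⟩ := hL.exists_isMaxOn
    ⟨p, subset_closure (mem_connectedComponentIn hp), hpV⟩
    (f := fun x => dist x a) (by fun_prop)
  -- A point of `closure C` outside `C` would lie in `A`, hence in `V`.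
  have hqC' : q ∈ C :=
    hAo.closure_connectedComponentIn_inter_subset p ⟨hqC, fun hqA => hqV (hAV hqA)⟩
  refine hqV (hV.mem_of_farther_subset hn (a := a) ?_
    (hAo.connectedComponentIn.mem_nhds hqC') fun x hx hlt => ?_)
  · rintro rfl
    exact hqV (hAV ha)
  · by_contra hxV
    exact (hqmax ⟨subset_closure hx, hxV⟩).not_gt hlt
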